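/- Fix $d\in\mathbb N_0$, $T>0$ and a function $\omega:(0,1]\to(0,\infty)$ with $\omega(\varepsilon)\to 0$ as $\varepsilon\to 0$. Let $q\in\mathcal D'(\mathbb R^d)$ be a real distribution and $u_0\in H^1(\mathbb R^d)$ (complex valued). A Friedrichs mollifier is a function $\psi\in C_c^\infty(\mathbb R^d)$ with $\psi\ge 0$ and $\int\psi=1$; put $\psi_\varepsilon(x)=\omega(\varepsilon)^{-d}\psi(x/\omega(\varepsilon))$. A regularisation of $q$ (of $u_0$) is a net $q_\varepsilon=q*\psi_\varepsilon$ ($u_{0,\varepsilon}=u_0*\psi_\varepsilon$), $\varepsilon\in(0,1]$, for some Friedrichs mollifier $\psi$. As usual for singular $q$, "$q\ge 0$" means that all regularisations $q_\varepsilon$ under consideration are non-negative functions. The regularisations under consideration are also assumed moderate: there are $N,N_0\in\mathbb N_0$ and $C,C_0>0$ with $\|q_\varepsilon\|_{L^\infty}\le C\,\omega(\varepsilon)^{-N}$ and $\|u_{0,\varepsilon}\|_{H^1}\le C_0\,\omega(\varepsilon)^{-N_0}$ for all $\varepsilon\in(0,1]$. Then the very weak solution of $\partial_t u-\Delta u+qu=0$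 in $(0,T)\times\mathbb R^d$, $u(0,\cdot)=u_0$, is unique in the following sense. Let $(q_\varepsilon)$, $(\tilde q_\varepsilon)$ be non-negative, $L^\infty$-moderate regularisations of $q$, and let $(u_{0,\varepsilon})$, $(\tilde u_{0,\varepsilon})$ be $H^1$-moderate regularisations of $u_0$, such that for all $k>0$ and all $l>0$ there are constants $C_k$, $C'_l$ with $$\|q_\varepsilon-\tilde q_\varepsilon\|_{L^\infty}\le C_k\varepsilon^k,\qquad \|u_{0,\varepsilon}-\tilde u_{0,\varepsilon}\|_{L^2}\le C'_l\varepsilon^l\qquad(\varepsilon\in(0,1]).$$ For each $\varepsilon\in(0,1]$ let $u_\varepsilon,\tilde u_\varepsilon\in C^1([0,T];L^2(\mathbb R^d))\cap C([0,T];H^1(\mathbb R^d))$ solve $$\partial_tu_\varepsilon-\Delta u_\varepsilon+q_\varepsilon u_\varepsilon=0,\quad u_\varepsilon(0)=u_{0,\varepsilon},\qquad\qquad \partial_t\tilde u_\varepsilon-\Delta\tilde u_\varepsilon+\tilde q_\varepsilon\tilde u_\varepsilon=0,\quad \tilde u_\varepsilon(0)=\tilde u_{0,\varepsilon}$$ in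 $(0,T)\times\mathbb R^d$, where $\Delta$ is taken in the sense of distributions. Then for every $N>0$ there is a constant $C_N$ such that $$\|u_\varepsilon(t,\cdot)-\tilde u_\varepsilon(t,\cdot)\|_{L^2}\le C_N\varepsilon^N\qquad\text{for all }\varepsilon\in(0,1],\ t\in[0,T].$$ -/

import Mathlib

open MeasureTheory Set Filter Topology
open scoped ENNReal SchwartzMap LineDeriv Laplacian Distributions

noncomputable section

namespace VeryWeakHeat

/-- The Euclidean space `ℝᵈ`. -/
abbrev Space (d : ℕ) : Type := EuclideanSpace ℝ (Fin d)

/-- The complex Hilbert space `L²(ℝᵈ)`. -/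
abbrev L2 (d : ℕ) : Type := Lp ℂ 2 (volume : Measure (Space d))

/-- Real test functions `C_c^∞(ℝᵈ)`. -/
abbrev Test (d : ℕ) : Type := 𝓓((⊤ : TopologicalSpace.Opens (Space d)), ℝ)

/-- Real distributions `𝓓'(ℝᵈ)`. -/
abbrev Distrib (d : ℕ) : Type := 𝓓'((⊤ : TopologicalSpace.Opens (Space d)), ℝ)

/-! ### The Sobolev space `H¹` -/

/-- The Sobolev space `H¹(ℝᵈ)`: an element is a pair `(u, ∇u)`, where `u ∈ L²` and the components
of `∇u` are functions in `L²` which are the distributional partial derivatives of `u`. It carries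
the norm `(‖u‖² + ‖∇u‖²)^{1/2}`. -/
def H1 (d : ℕ) : Submodule ℂ (WithLp 2 (L2 d × PiLp 2 (fun _ : Fin d => L2 d))) where
  carrier := {p | ∀ i : Fin d,
    ∂_{EuclideanSpace.single i (1 : ℝ)} (Lp.toTemperedDistribution p.fst : 𝓢'(Space d, ℂ)) =
      Lp.toTemperedDistribution (p.snd i)}
  zero_mem' := by
    intro i
    change ∂_{EuclideanSpace.single i (1 : ℝ)} (Lp.toTemperedDistributionCLM ℂ volume 2 (0 : L2 d)) =
      Lp.toTemperedDistributionCLM ℂ volume 2 (0 : L2 d)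
    rw [map_zero]
    exact LineDeriv.lineDerivOp_zero _
  add_mem' := by
    intro p p' hp hp' i
    change ∂_{EuclideanSpace.single i (1 : ℝ)}
        (Lp.toTemperedDistributionCLM ℂ volume 2 (p.fst + p'.fst)) =
      Lp.toTemperedDistributionCLM ℂ volume 2 (p.snd i + p'.snd i)
    rw [map_add, map_add, LineDeriv.lineDerivOp_add]
    exact congrArg₂ (· + ·) (hp i) (hp' i)
  smul_mem' := by
    intro c p hp i
    change ∂_{EuclideanSpace.single i (1 : ℝ)}
        (Lp.toTemperedDistributionCLM ℂ volume 2 (c • p.fst)) =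
      Lp.toTemperedDistributionCLM ℂ volume 2 (c • p.snd i)
    rw [map_smul, map_smul, LineDeriv.lineDerivOp_smul]
    exact congrArg (c • ·) (hp i)

/-- The `L²` function underlying an element of `H¹`. -/
def toL2 {d : ℕ} (u : H1 d) : L2 d := (u : WithLp 2 (L2 d × PiLp 2 (fun _ : Fin d => L2 d))).fst

/-- The weak gradient of an element of `H¹`. -/
def grad {d : ℕ} (u : H1 d) : PiLp 2 (fun _ : Fin d => L2 d) :=
  (u : WithLp 2 (L2 d × PiLp 2 (fun _ : Fin d => L2 d))).snd

theorem H1.norm_sq {d : ℕ} (u : H1 d) :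
    ‖u‖ ^ 2 = ‖toL2 u‖ ^ 2 + ∑ i, ‖grad u i‖ ^ 2 := by
  have h := WithLp.prod_norm_sq_eq_of_L2
    (u : WithLp 2 (L2 d × PiLp 2 (fun _ : Fin d => L2 d)))
  rw [← PiLp.norm_sq_eq_of_L2]
  exact h

/-! ### Regularisation by mollifiers -/

/-- Friedrichs mollifiers: `ψ ∈ C_c^∞(ℝᵈ)`, `ψ ≥ 0` and `∫ ψ = 1`. -/
def IsFriedrichsMollifier {d : ℕ} (ψ : Test d) : Prop :=
  (∀ x, 0 ≤ ψ x) ∧ ∫ x, ψ x = 1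

/-- The test function `y ↦ ψ_δ(x - y)`, where `ψ_δ(z) = δ^{-d} ψ(z / δ)`, at the scale `δ > 0`.
(The scale `0` is given the value `0`; it never occurs.) -/
def mollifierAt {d : ℕ} (ψ : Test d) (δ : ℝ) (x : Space d) : Test d where
  toFun y := if δ = 0 then 0 else (δ ^ d)⁻¹ * ψ (δ⁻¹ • (x - y))
  contDiff' := by
    by_cases h : δ = 0
    · simp only [h, if_true]
      exact contDiff_const
    · simp only [h, if_false]
      exact contDiff_const.mul (ψ.contDiff.comp ((contDiff_const.sub contDiff_id).const_smul _))
  hasCompactSupport' := by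
    by_cases h : δ = 0
    · simp only [h, if_true]
      exact HasCompactSupport.zero
    · simp only [h, if_false]
      have h1 : HasCompactSupport fun y => ψ (δ⁻¹ • (x - y)) :=
        ψ.hasCompactSupport.comp_homeomorph
          ((Homeomorph.subLeft x).trans (Homeomorph.smulOfNeZero δ⁻¹ (inv_ne_zero h)))
      exact h1.mul_left (f := fun _ => (δ ^ d)⁻¹)
  tsupport_subset' := fun _ _ => trivial

/-- The convolution `q * ψ_δ` of a distribution `q` with the rescaled mollifier. -/
def Distrib.mollify {d : ℕ} (q : Distrib d) (ψ : Test d) (δ : ℝ) (x : Space d) : ℝ :=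
  q (mollifierAt ψ δ x)

/-- The convolution `u * ψ_δ` of a function `u ∈ L²` with the rescaled mollifier. -/
def L2.mollify {d : ℕ} (u : L2 d) (ψ : Test d) (δ : ℝ) (x : Space d) : ℂ :=
  ∫ y, mollifierAt ψ δ x y • u y

/-- The net of functions `(q_ε)_{ε ∈ (0,1]}` is a regularisation of the distribution `q`
(at the scale `ω`): `q_ε = q * ψ_{ω(ε)}` for a Friedrichs mollifier `ψ`. -/
def IsCoeffRegularisation {d : ℕ} (ω : ℝ → ℝ) (q : Distrib d) (qe : ℝ → Space d → ℝ) : Prop :=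
  ∃ ψ : Test d, IsFriedrichsMollifier ψ ∧
    ∀ ε ∈ Ioc (0 : ℝ) 1, ∀ x, qe ε x = q.mollify ψ (ω ε) x

/-- The net `(u_{0,ε})_{ε ∈ (0,1]}` in `H¹` is a regularisation of `u₀` (at the scale `ω`):
`u_{0,ε} = u₀ * ψ_{ω(ε)}` for a Friedrichs mollifier `ψ`. -/
def IsDataRegularisation {d : ℕ} (ω : ℝ → ℝ) (u₀ : H1 d) (ue : ℝ → H1 d) : Prop :=
  ∃ ψ : Test d, IsFriedrichsMollifier ψ ∧
    ∀ ε ∈ Ioc (0 : ℝ) 1, ∀ᵐ x, toL2 (ue ε) x = L2.mollify (toL2 u₀) ψ (ω ε) x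

/-- A net with norms `n ε`, `ε ∈ (0,1]`, is moderate: `n ε ≤ c ω(ε)^{-N}` for some `N` and `c`. -/
def IsModerate (ω : ℝ → ℝ) (n : ℝ → ℝ≥0∞) : Prop :=
  ∃ N : ℕ, ∃ c : ℝ, 0 < c ∧ ∀ ε ∈ Ioc (0 : ℝ) 1, n ε ≤ ENNReal.ofReal (c * ((ω ε) ^ N)⁻¹)

/-- A net with norms `n ε`, `ε ∈ (0,1]`, is negligible: for every `k > 0` there is a constant `C_k`
with `n ε ≤ C_k ε^k`. -/
def IsNegligible (n : ℝ → ℝ≥0∞) : Prop :=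
  ∀ k : ℕ, 0 < k → ∃ C : ℝ, ∀ ε ∈ Ioc (0 : ℝ) 1, n ε ≤ ENNReal.ofReal (C * ε ^ k)

/-- The regularisations of `q` which are admitted: those that are non-negative functions
(this is the meaning of `q ≥ 0` for a singular `q`) and `L^∞`-moderate. -/
structure IsAdmissibleCoeffNet {d : ℕ} (ω : ℝ → ℝ) (q : Distrib d) (qe : ℝ → Space d → ℝ) :
    Prop where
  regularisation : IsCoeffRegularisation ω q qe
  nonneg : ∀ ε ∈ Ioc (0 : ℝ) 1, ∀ x, 0 ≤ qe ε x
  moderate : IsModerate ω fun ε => eLpNorm (qe ε) ∞ volume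

/-- The regularisations of `u₀` which are admitted: those that are `H¹`-moderate. -/
structure IsAdmissibleDataNet {d : ℕ} (ω : ℝ → ℝ) (u₀ : H1 d) (ue : ℝ → H1 d) : Prop where
  regularisation : IsDataRegularisation ω u₀ ue
  moderate : IsModerate ω fun ε => ‖ue ε‖ₑ

/-! ### The Cauchy problem -/

/-- `u ∈ C¹([0,T]; L²) ∩ C([0,T]; H¹)` solves `∂ₜu - Δu + q u = 0` in `(0,T) × ℝᵈ` and
`u(0) = u₀`. Here `Δ u(t)` is the Laplacian in the sense of distributions; since the other terms
of the equation are in `L²` (for bounded `q`), it is represented by a function `w` in `L²`. -/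
structure SolvesHeat {d : ℕ} (T : ℝ) (q : Space d → ℝ) (u₀ : H1 d) (u : ℝ → H1 d) : Prop where
  continuousOn : ContinuousOn u (Icc 0 T)
  contDiffOn : ContDiffOn ℝ 1 (fun t => toL2 (u t)) (Icc 0 T)
  equation : ∀ t ∈ Ioo 0 T, ∃ w : L2 d,
    Δ (Lp.toTemperedDistribution (toL2 (u t)) : 𝓢'(Space d, ℂ)) = Lp.toTemperedDistribution w ∧
    ∀ᵐ x, derivWithin (fun s => toL2 (u s)) (Icc 0 T) t x - w x + (q x : ℂ) * toL2 (u t) x = 0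
  initial : u 0 = u₀

/-- Uniqueness of the very weak solution for the data `q ≥ 0`, `u₀`: solution nets
for regularisations that differ by negligible nets (in `L^∞` for the coefficient and in `L²` for
the initial data) differ by a negligible net in `L²`, uniformly in `t ∈ [0,T]`. -/
def VeryWeakSolutionUnique {d : ℕ} (T : ℝ) (ω : ℝ → ℝ) (q : Distrib d) (u₀ : H1 d) : Prop :=
  ∀ qe qe' : ℝ → Space d → ℝ, ∀ u₀e u₀e' : ℝ → H1 d,
    IsAdmissibleCoeffNet ω q qe → IsAdmissibleCoeffNet ω q qe' →
    IsAdmissibleDataNet ω u₀ u₀e → IsAdmissibleDataNet ω u₀ u₀e' →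
    IsNegligible (fun ε => eLpNorm (qe ε - qe' ε) ∞ volume) →
    IsNegligible (fun ε => ‖toL2 (u₀e ε) - toL2 (u₀e' ε)‖ₑ) →
    ∀ u u' : ℝ → ℝ → H1 d,
      (∀ ε ∈ Ioc (0 : ℝ) 1, SolvesHeat T (qe ε) (u₀e ε) (u ε)) →
      (∀ ε ∈ Ioc (0 : ℝ) 1, SolvesHeat T (qe' ε) (u₀e' ε) (u' ε)) →
      ∀ N : ℕ, 0 < N → ∃ C : ℝ, ∀ ε ∈ Ioc (0 : ℝ) 1, ∀ t ∈ Icc 0 T,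
        ‖toL2 (u ε t) - toL2 (u' ε t)‖ ≤ C * ε ^ N

end VeryWeakHeat

end

/-! The proof is an energy estimate for `v = u_ε - ũ_ε`, which satisfies `∂ₜv = Δv - q_ε v - (q_ε -
q̃_ε) ũ_ε`. Paired with `v`, the first two terms have non-positive real part: the Laplacian by
Plancherel (`re_inner_laplacian_nonpos`), the second by `q_ε ≥ 0`. Only the coefficient difference,
negligible in `L^∞`, can make `‖v‖²` grow (`SolvesHeat.norm_sub_sq_le`). Its factor `ũ_ε` is bounded
uniformly in `ε`: the energy decays (`SolvesHeat.norm_le`), and mollification contracts `L²`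
(`IsFriedrichsMollifier.norm_le_of_ae_eq_mollify`), so `‖u₀‖` bounds both solutions at all times.
Hence no comparison of `ω(ε)` with powers of `ε` is needed, and no Gronwall argument either. -/

namespace VeryWeakHeat

/-! ### Mollification as a contraction of `L²` -/

/-- Jensen's inequality for the square and a weight of total mass `1`. -/
theorem lintegral_mul_sq_le {α : Type*} [MeasurableSpace α] {μ : Measure α} {k g : α → ℝ≥0∞}
    (hk : AEMeasurable k μ) (hg : AEMeasurable g μ) (hk1 : ∫⁻ y, k y ∂μ ≤ 1) :
    (∫⁻ y, k y * g y ∂μ) ^ 2 ≤ ∫⁻ y, k y * g y ^ 2 ∂μ := by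
  -- Cauchy–Schwarz for the splitting `k g = k^{1/2} · (k^{1/2} g)`.
  have h := ENNReal.lintegral_mul_le_Lp_mul_Lq μ Real.HolderConjugate.two_two
    (f := fun y => k y ^ (1 / 2 : ℝ)) (g := fun y => k y ^ (1 / 2 : ℝ) * g y)
    (hk.pow_const _) ((hk.pow_const _).mul hg)
  have e1 : ∀ y, k y ^ (1 / 2 : ℝ) * (k y ^ (1 / 2 : ℝ) * g y) = k y * g y := fun y => by
    rw [← mul_assoc, ← ENNReal.rpow_add_of_nonneg _ _ (by norm_num) (by norm_num)]
    norm_num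
  have e2 : ∀ y, (k y ^ (1 / 2 : ℝ)) ^ (2 : ℝ) = k y := fun y => by
    rw [← ENNReal.rpow_mul]; norm_num
  have e3 : ∀ y, (k y ^ (1 / 2 : ℝ) * g y) ^ (2 : ℝ) = k y * g y ^ 2 := fun y => by
    rw [ENNReal.mul_rpow_of_nonneg _ _ (by norm_num), e2, ENNReal.rpow_two]
  simp only [Pi.mul_apply, e1, e2, e3] at h
  have h2 : (∫⁻ y, k y ∂μ) ^ (1 / 2 : ℝ) ≤ 1 := ENNReal.rpow_le_one hk1 (by norm_num)
  calc (∫⁻ y, k y * g y ∂μ) ^ 2 ≤ (1 * (∫⁻ y, k y * g y ^ 2 ∂μ) ^ (1 / 2 : ℝ)) ^ 2 := by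
        gcongr
        exact h.trans (by gcongr)
    _ = ∫⁻ y, k y * g y ^ 2 ∂μ := by
        rw [one_mul, ← ENNReal.rpow_two, ← ENNReal.rpow_mul]; norm_num

theorem mollifierAt_apply {d : ℕ} (ψ : Test d) {δ : ℝ} (hδ : 0 < δ) (x y : Space d) :
    mollifierAt ψ δ x y = (δ ^ d)⁻¹ * ψ (δ⁻¹ • (x - y)) := by
  change (if δ = 0 then 0 else (δ ^ d)⁻¹ * ψ (δ⁻¹ • (x - y))) = _
  rw [if_neg hδ.ne']

/-- The rescaled mollifier has total mass `1`. -/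
theorem IsFriedrichsMollifier.lintegral_rescale {d : ℕ} {ψ : Test d} (hψ : IsFriedrichsMollifier ψ)
    {δ : ℝ} (hδ : 0 < δ) :
    ∫⁻ z : Space d, ENNReal.ofReal ((δ ^ d)⁻¹ * ψ (δ⁻¹ • z)) = 1 := by
  have hint : Integrable (fun z : Space d => ψ z) :=
    ψ.contDiff.continuous.integrable_of_hasCompactSupport ψ.hasCompactSupport
  have hint' : Integrable (fun z : Space d => (δ ^ d)⁻¹ * ψ (δ⁻¹ • z)) :=
    (hint.comp_smul (inv_ne_zero hδ.ne')).const_mul _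
  rw [← ofReal_integral_eq_lintegral_ofReal hint'
    (ae_of_all _ fun z => mul_nonneg (by positivity) (hψ.1 _)), integral_const_mul,
    Measure.integral_comp_smul, hψ.2, finrank_euclideanSpace_fin, inv_pow, inv_inv,
    abs_of_pos (by positivity), smul_eq_mul, mul_one, inv_mul_cancel₀ (by positivity),
    ENNReal.ofReal_one]

/-- Mollification does not increase the `L²` norm. -/
theorem IsFriedrichsMollifier.norm_le_of_ae_eq_mollify {d : ℕ} {ψ : Test d}
    (hψ : IsFriedrichsMollifier ψ) {δ : ℝ} (hδ : 0 < δ) {u v : L2 d}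
    (hv : ∀ᵐ x, v x = L2.mollify u ψ δ x) : ‖v‖ ≤ ‖u‖ := by
  set k : Space d → ℝ≥0∞ := fun z => ENNReal.ofReal ((δ ^ d)⁻¹ * ψ (δ⁻¹ • z)) with hk
  have hkm : Measurable k := by
    have := ψ.contDiff.continuous
    have hc : Continuous fun z : Space d => (δ ^ d)⁻¹ * ψ (δ⁻¹ • z) := by fun_prop
    exact hc.measurable.ennreal_ofReal
  have hum : Measurable fun y => ‖u y‖ₑ := (Lp.stronglyMeasurable u).enorm
  have hk1 : ∫⁻ z, k z = 1 := hψ.lintegral_rescale hδ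
  -- Jensen for the probability weight `y ↦ k (x - y)`. After Tonelli the same kernel is integrated
  -- in `x`, where its mass is again `1`.
  have hpt : ∀ x, ‖L2.mollify u ψ δ x‖ₑ ^ 2 ≤ ∫⁻ y, k (x - y) * ‖u y‖ₑ ^ 2 := by
    intro x
    refine le_trans ?_ (lintegral_mul_sq_le (by fun_prop) hum.aemeasurable
      (by rw [lintegral_sub_left_eq_self k x, hk1]))
    gcongr
    refine (enorm_integral_le_lintegral_enorm _).trans (le_of_eq (lintegral_congr fun y => ?_))
    rw [enorm_smul, mollifierAt_apply ψ hδ,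
      Real.enorm_of_nonneg (mul_nonneg (by positivity) (hψ.1 _))]
  have hsq : ∀ f : L2 d, ‖f‖ₑ ^ 2 = ∫⁻ x, ‖f x‖ₑ ^ 2 := by
    intro f
    rw [Lp.enorm_def, eLpNorm_eq_lintegral_rpow_enorm_toReal (by norm_num) (by norm_num),
      ← ENNReal.rpow_two, ← ENNReal.rpow_mul]
    simp
  have hfin : ‖v‖ₑ ^ 2 ≤ ‖u‖ₑ ^ 2 := by
    rw [hsq, hsq]
    calc ∫⁻ x, ‖v x‖ₑ ^ 2 ≤ ∫⁻ x, ∫⁻ y, k (x - y) * ‖u y‖ₑ ^ 2 := by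
          refine lintegral_mono_ae ?_
          filter_upwards [hv] with x hx
          rw [hx]; exact hpt x
      _ = ∫⁻ y, ∫⁻ x, k (x - y) * ‖u y‖ₑ ^ 2 :=
          lintegral_lintegral_swap (by
            apply Measurable.aemeasurable
            unfold Function.uncurry
            exact (hkm.comp (measurable_fst.sub measurable_snd)).mul
              ((hum.comp measurable_snd).pow_const 2))
      _ = ∫⁻ y, ‖u y‖ₑ ^ 2 := by
          refine lintegral_congr fun y => ?_
          rw [lintegral_mul_const _ (by fun_prop), lintegral_sub_right_eq_self k y, hk1, one_mul]
  have : ‖v‖ₑ ≤ ‖u‖ₑ := (ENNReal.pow_le_pow_left_iff two_ne_zero).mp hfin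
  exact enorm_le_iff_norm_le.mp this

/-! ### Dissipativity of the Laplacian via Plancherel -/

section Fourier

open scoped FourierTransform Real
open TemperedDistribution

/-- If `u` and `Δu = w` are in `L²`, then `û` and `ŵ` are related by `ŵ = -4π²|ξ|² û`. -/
theorem fourier_eq_of_laplacian_eq {d : ℕ} {u w : L2 d}
    (h : Δ (Lp.toTemperedDistribution u : 𝓢'(Space d, ℂ)) = Lp.toTemperedDistribution w) :
    ∀ᵐ x : Space d, (𝓕 w : L2 d) x = -((2 * π) ^ 2 * ‖x‖ ^ 2 : ℝ) * (𝓕 u : L2 d) x := by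
  have hbound : ∀ x : Space d, ‖((((1 + ‖x‖ ^ 2) ^ (-1 : ℝ) : ℝ) : ℂ))‖ ≤ 1 := by
    intro x
    rw [Complex.norm_real, Real.norm_of_nonneg (by positivity)]
    exact Real.rpow_le_one_of_one_le_of_nonpos (by simp) (by norm_num)
  have hbound' : ∀ x : Space d, ‖(((‖x‖ ^ 2 * (1 + ‖x‖ ^ 2) ^ (-1 : ℝ) : ℝ) : ℂ))‖ ≤ 1 := by
    intro x
    rw [Complex.norm_real, Real.norm_of_nonneg (by positivity), Real.rpow_neg_one,
      ← div_eq_mul_inv, div_le_one (by positivity)]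
    simp
  have ht : (fun x : Space d ↦ (((1 + ‖x‖ ^ 2) ^ (-1 : ℝ) : ℝ) : ℂ)).HasTemperateGrowth := by
    fun_prop
  have ht' : (fun x : Space d ↦
      ((‖x‖ ^ 2 * (1 + ‖x‖ ^ 2) ^ (-1 : ℝ) : ℝ) : ℂ)).HasTemperateGrowth := by
    fun_prop
  have hm := memLp_top_of_bound (μ := (volume : Measure (Space d)))
    ht.1.continuous.aestronglyMeasurable 1 (ae_of_all _ hbound)
  have hm' := memLp_top_of_bound (μ := (volume : Measure (Space d)))
    ht'.1.continuous.aestronglyMeasurable 1 (ae_of_all _ hbound')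
  -- The factor `(1 + |ξ|²)⁻¹` makes both multipliers bounded: `|ξ|² û` is not yet known to be in
  -- `L²`, whereas now both sides are, and the injectivity of `L² → 𝓢'` applies. The factor is
  -- divided out pointwise afterwards.
  have key : (hm.toLp _) • (𝓕 w : L2 d) = (-(2 * π) ^ 2 : ℂ) • ((hm'.toLp _) • (𝓕 u : L2 d)) := by
    have hinj : Function.Injective (Lp.toTemperedDistributionCLM ℂ (volume : Measure (Space d)) 2) :=
      LinearMap.ker_eq_bot.mp Lp.ker_toTemperedDistributionCLM_eq_bot
    apply hinj
    rw [map_smul, Lp.toTemperedDistributionCLM_apply, Lp.toTemperedDistributionCLM_apply,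
      Lp.toTemperedDistribution_smul_eq ht, Lp.toTemperedDistribution_smul_eq ht',
      ← Lp.fourier_toTemperedDistribution_eq, ← Lp.fourier_toTemperedDistribution_eq, ← h,
      laplacian_eq_fourierMultiplierCLM, fourierMultiplierCLM_apply]
    have hg := FourierTransform.fourier_fourierInv_eq (E := 𝓢'(Space d, ℂ))
      (F := 𝓢'(Space d, ℂ)) (smulLeftCLM ℂ (fun x : Space d ↦ Complex.ofReal (‖x‖ ^ 2))
        (𝓕 (Lp.toTemperedDistribution u : 𝓢'(Space d, ℂ))))
    rw [← Complex.coe_smul, FourierTransform.fourier_smul, hg, map_smul,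
      smulLeftCLM_smulLeftCLM_apply (by fun_prop) ht]
    congr 2
    · push_cast; ring
    · congr 1
      ext x
      simp
  filter_upwards [Lp.coeFn_lpSMul (r := 2) (hm.toLp _) (𝓕 w : L2 d),
    Lp.coeFn_smul (-(2 * π) ^ 2 : ℂ) ((hm'.toLp _) • (𝓕 u : L2 d)),
    Lp.coeFn_lpSMul (r := 2) (hm'.toLp _) (𝓕 u : L2 d), hm.coeFn_toLp, hm'.coeFn_toLp]
    with x h1 h2 h3 h4 h5
  rw [key, h2, Pi.smul_apply, h3, Pi.smul_apply', Pi.smul_apply', h4, h5] at h1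
  have hpos : (0 : ℝ) < 1 + ‖x‖ ^ 2 := by positivity
  have hne : (((1 + ‖x‖ ^ 2 : ℝ)) : ℂ) ≠ 0 := by exact_mod_cast hpos.ne'
  rw [Real.rpow_neg_one] at h1
  simp only [smul_eq_mul, Complex.ofReal_mul, Complex.ofReal_inv] at h1
  have h6 := congrArg (fun z => ((1 + ‖x‖ ^ 2 : ℝ) : ℂ) * z) h1
  field_simp at h6
  rw [← h6]
  push_cast
  ring

/-- `Re ⟨u, Δu⟩ ≤ 0` if `u` and `Δu = w` are in `L²`. -/
theorem re_inner_laplacian_nonpos {d : ℕ} {u w : L2 d}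
    (h : Δ (Lp.toTemperedDistribution u : 𝓢'(Space d, ℂ)) = Lp.toTemperedDistribution w) :
    (inner ℂ u w : ℂ).re ≤ 0 := by
  rw [← Lp.inner_fourier_eq, L2.inner_def]
  have hi := L2.integrable_inner (𝕜 := ℂ) (𝓕 u : L2 d) (𝓕 w : L2 d)
  rw [← RCLike.re_eq_complex_re, ← integral_re hi]
  apply integral_nonpos_of_ae
  filter_upwards [fourier_eq_of_laplacian_eq h] with x hx
  rw [hx]
  have : inner ℂ ((𝓕 u : L2 d) x) (-(((2 * π) ^ 2 * ‖x‖ ^ 2 : ℝ) : ℂ) * (𝓕 u : L2 d) x)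
      = ((-((2 * π) ^ 2 * ‖x‖ ^ 2 * ‖(𝓕 u : L2 d) x‖ ^ 2) : ℝ) : ℂ) := by
    rw [← smul_eq_mul, inner_smul_right, inner_self_eq_norm_sq_to_K]
    change _ * ((‖(𝓕 u : L2 d) x‖ : ℝ) : ℂ) ^ 2 = _
    push_cast
    ring
  rw [this]
  simp only [RCLike.re_eq_complex_re, Complex.ofReal_re, Pi.zero_apply, Left.neg_nonpos_iff]
  positivity

end Fourier

/-! ### Energy estimates -/

/-- A lower bound of the pointwise product with `v` by `a |f| |v|`, integrated. -/
theorem le_re_inner_of_ae_le {d : ℕ} {v g f : L2 d} {a : ℝ} (ha : 0 ≤ a)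
    (h : ∀ᵐ x, -(a * (‖f x‖ * ‖v x‖)) ≤ (inner ℂ (v x) (g x) : ℂ).re) :
    -(a * (‖f‖ * ‖v‖)) ≤ (inner ℂ v g : ℂ).re := by
  have hi := L2.integrable_inner (𝕜 := ℂ) v g
  have hfv : Integrable fun x => ‖f x‖ * ‖v x‖ :=
    (Lp.memLp f).norm.integrable_mul (Lp.memLp v).norm
  have hle : ∫ x, ‖f x‖ * ‖v x‖ ≤ ‖f‖ * ‖v‖ := by
    have h1 := real_inner_le_norm (Lp.memLp f).norm.toLp (Lp.memLp v).norm.toLp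
    rw [Lp.norm_toLp, Lp.norm_toLp, eLpNorm_norm, eLpNorm_norm, ← Lp.norm_def, ← Lp.norm_def,
      L2.inner_def] at h1
    refine le_trans (le_of_eq (integral_congr_ae ?_)) h1
    filter_upwards [(Lp.memLp f).norm.coeFn_toLp, (Lp.memLp v).norm.coeFn_toLp] with x e1 e2
    rw [e1, e2]
    simp [mul_comm]
  rw [L2.inner_def, ← RCLike.re_eq_complex_re, ← integral_re hi]
  calc -(a * (‖f‖ * ‖v‖)) ≤ -(a * ∫ x, ‖f x‖ * ‖v x‖) := by gcongr
    _ = ∫ x, -(a * (‖f x‖ * ‖v x‖)) := by rw [integral_neg, integral_const_mul]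
    _ ≤ _ := integral_mono_ae (hfv.const_mul a).neg hi.re h

/-- The product of the coefficient and the solution is in `L²` and the equation holds there. -/
theorem SolvesHeat.hasDerivAt {d : ℕ} {T : ℝ} {q : Space d → ℝ} {u₀ : H1 d} {u : ℝ → H1 d}
    (hu : SolvesHeat T q u₀ u) {t : ℝ} (ht : t ∈ Ioo 0 T) :
    ∃ w g : L2 d,
      Δ (Lp.toTemperedDistribution (toL2 (u t)) : 𝓢'(Space d, ℂ)) = Lp.toTemperedDistribution w ∧
      (∀ᵐ x, g x = (q x : ℂ) * toL2 (u t) x) ∧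
      HasDerivAt (fun s => toL2 (u s)) (w - g) t := by
  obtain ⟨w, hw, hae⟩ := hu.equation t ht
  have hmem : Icc 0 T ∈ 𝓝 t := Icc_mem_nhds ht.1 ht.2
  have hd := (hu.contDiffOn.differentiableOn one_ne_zero t
    (Ioo_subset_Icc_self ht)).hasDerivWithinAt.hasDerivAt hmem
  -- Defining `g` as `Δu - ∂ₜu` puts `q u` in `L²` by the equation itself, without measurability or
  -- boundedness of `q`.
  refine ⟨w, w - derivWithin (fun s => toL2 (u s)) (Icc 0 T) t, hw, ?_, by rwa [sub_sub_cancel]⟩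
  filter_upwards [hae, Lp.coeFn_sub w (derivWithin (fun s => toL2 (u s)) (Icc 0 T) t)] with x h1 h2
  rw [h2, Pi.sub_apply]
  linear_combination -h1

/-- Integrated form of a differential inequality for `‖v‖²`. -/
theorem norm_sq_le_of_re_inner_le {E : Type*} [NormedAddCommGroup E] [InnerProductSpace ℂ E]
    {T b : ℝ} {v : ℝ → E} (hv : ContinuousOn v (Icc 0 T))
    (hd : ∀ t ∈ Ioo 0 T, ∃ v' : E, HasDerivAt v v' t ∧ (inner ℂ (v t) v' : ℂ).re ≤ b)
    {t : ℝ} (ht : t ∈ Icc 0 T) : ‖v t‖ ^ 2 ≤ ‖v 0‖ ^ 2 + 2 * b * t := by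
  let : InnerProductSpace ℝ E := InnerProductSpace.rclikeToReal ℂ E
  have hder : ∀ s ∈ Ioo 0 T, ∃ c ≤ 2 * b, HasDerivAt (fun r => ‖v r‖ ^ 2) c s := by
    intro s hs
    obtain ⟨v', hv', hb⟩ := hd s hs
    refine ⟨_, ?_, hv'.norm_sq⟩
    have : (inner ℝ (v s) v' : ℝ) = (inner ℂ (v s) v' : ℂ).re := rfl
    linarith
  have h0 : (0 : ℝ) ∈ Icc 0 T := ⟨le_rfl, ht.1.trans ht.2⟩
  -- The mean value inequality asks for derivatives only in the open interval, where the equation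
  -- holds.
  have := (convex_Icc (0 : ℝ) T).image_sub_le_mul_sub_of_deriv_le (f := fun r => ‖v r‖ ^ 2)
    (C := 2 * b) (hv.norm.pow 2)
    (by
      rw [interior_Icc]
      intro s hs
      obtain ⟨c, -, hc⟩ := hder s hs
      exact hc.differentiableAt.differentiableWithinAt)
    (by
      rw [interior_Icc]
      intro s hs
      obtain ⟨c, hcb, hc⟩ := hder s hs
      rwa [hc.deriv])
    0 h0 t ht ht.1
  simp only [sub_zero] at this
  linarith

/-- Energy estimate: the `L²` norm of the solution is non-increasing when `q ≥ 0`. -/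
theorem SolvesHeat.norm_le {d : ℕ} {T : ℝ} {q : Space d → ℝ} (hq : ∀ x, 0 ≤ q x) {u₀ : H1 d}
    {u : ℝ → H1 d} (hu : SolvesHeat T q u₀ u) {t : ℝ} (ht : t ∈ Icc 0 T) :
    ‖toL2 (u t)‖ ≤ ‖toL2 u₀‖ := by
  have h := norm_sq_le_of_re_inner_le (b := 0) hu.contDiffOn.continuousOn (fun s hs => by
    obtain ⟨w, g, hw, hg, hd⟩ := hu.hasDerivAt hs
    refine ⟨_, hd, ?_⟩
    have h1 := re_inner_laplacian_nonpos hw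
    -- With `f = 0` and `a = 0` the lower bound reads `0 ≤ Re ⟨u, q u⟩`.
    have h2 := le_re_inner_of_ae_le (v := toL2 (u s)) (g := g) (f := 0) (a := 0) le_rfl (by
      filter_upwards [hg] with x hx
      rw [hx, show (q x : ℂ) * toL2 (u s) x = (q x : ℂ) • toL2 (u s) x from rfl, inner_smul_right,
        inner_self_eq_norm_sq_to_K]
      change _ ≤ ((q x : ℂ) * ((‖toL2 (u s) x‖ : ℝ) : ℂ) ^ 2).re
      rw [← Complex.ofReal_pow, ← Complex.ofReal_mul, Complex.ofReal_re]
      have := mul_nonneg (hq x) (sq_nonneg ‖toL2 (u s) x‖)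
      linarith)
    rw [inner_sub_right, Complex.sub_re]
    linarith) ht
  rw [hu.initial] at h
  exact le_of_sq_le_sq (by linarith) (norm_nonneg _)

/-- Stability of the solution under perturbations of the coefficient and of the initial value. -/
theorem SolvesHeat.norm_sub_sq_le {d : ℕ} {T : ℝ} {q q' : Space d → ℝ} (hq : ∀ x, 0 ≤ q x)
    (hq' : ∀ x, 0 ≤ q' x) {a M : ℝ} (ha : 0 ≤ a) (hqq' : ∀ᵐ x, |q x - q' x| ≤ a)
    {u₀ u₀' : H1 d} {u u' : ℝ → H1 d} (hu : SolvesHeat T q u₀ u) (hu' : SolvesHeat T q' u₀' u')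
    (hM : ‖toL2 u₀‖ ≤ M) (hM' : ‖toL2 u₀'‖ ≤ M) {t : ℝ} (ht : t ∈ Icc 0 T) :
    ‖toL2 (u t) - toL2 (u' t)‖ ^ 2 ≤ ‖toL2 u₀ - toL2 u₀'‖ ^ 2 + 4 * a * M ^ 2 * T := by
  -- `b` bounds `a ‖v'‖ ‖v - v'‖`, with `‖v'‖ ≤ M` and `‖v - v'‖ ≤ 2 M`.
  have h := norm_sq_le_of_re_inner_le (b := 2 * a * M ^ 2)
    (hu.contDiffOn.continuousOn.sub hu'.contDiffOn.continuousOn) (fun s hs => by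
    obtain ⟨w, g, hw, hg, hd⟩ := hu.hasDerivAt hs
    obtain ⟨w', g', hw', hg', hd'⟩ := hu'.hasDerivAt hs
    refine ⟨_, hd.sub hd', ?_⟩
    have hs' := Ioo_subset_Icc_self hs
    have hn := (hu.norm_le hq hs').trans hM
    have hn' := (hu'.norm_le hq' hs').trans hM'
    simp only [Pi.sub_apply]
    set v := toL2 (u s) with hv
    set v' := toL2 (u' s) with hv'
    have h1 : (inner ℂ (v - v') (w - w') : ℂ).re ≤ 0 := by
      refine re_inner_laplacian_nonpos ?_
      rw [← Lp.toTemperedDistributionCLM_apply, ← TemperedDistribution.laplacianCLM_apply, map_sub,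
        map_sub, Lp.toTemperedDistributionCLM_apply, Lp.toTemperedDistributionCLM_apply,
        TemperedDistribution.laplacianCLM_apply, TemperedDistribution.laplacianCLM_apply, hw, hw',
        ← Lp.toTemperedDistributionCLM_apply, ← Lp.toTemperedDistributionCLM_apply, ← map_sub,
        Lp.toTemperedDistributionCLM_apply]
    have h2 := le_re_inner_of_ae_le (v := v - v') (g := g - g') (f := v') ha (by
      filter_upwards [hg, hg', Lp.coeFn_sub v v', Lp.coeFn_sub g g', hqq'] with x e1 e2 e3 e4 e5
      rw [e4, e3, Pi.sub_apply, Pi.sub_apply, e1, e2]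
      -- The first summand pairs non-negatively with `v - v'`; the second is the perturbation.
      have : (q x : ℂ) * v x - (q' x : ℂ) * v' x
          = (q x : ℂ) • (v x - v' x) + ((q x - q' x : ℝ) : ℂ) • v' x := by
        simp only [smul_eq_mul]; push_cast; ring
      rw [this, inner_add_right, inner_smul_right, inner_smul_right, inner_self_eq_norm_sq_to_K]
      change _ ≤ ((q x : ℂ) * ((‖v x - v' x‖ : ℝ) : ℂ) ^ 2 + _).re
      rw [← Complex.ofReal_pow, ← Complex.ofReal_mul, Complex.add_re, Complex.ofReal_re,
        Complex.re_ofReal_mul]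
      have i1 := mul_nonneg (hq x) (sq_nonneg ‖v x - v' x‖)
      have i2 : |(q x - q' x) * (inner ℂ (v x - v' x) (v' x) : ℂ).re|
          ≤ a * (‖v' x‖ * ‖v x - v' x‖) := by
        rw [abs_mul, mul_comm ‖v' x‖]
        gcongr
        exact (Complex.abs_re_le_norm _).trans (norm_inner_le_norm _ _)
      linarith [neg_abs_le ((q x - q' x) * (inner ℂ (v x - v' x) (v' x) : ℂ).re)])
    have h3 : ‖v'‖ * ‖v - v'‖ ≤ M * (2 * M) := by
      have := norm_sub_le v v'
      gcongr
      · exact (norm_nonneg _).trans hn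
      · linarith
    have h4 := mul_le_mul_of_nonneg_left h3 ha
    rw [show w - g - (w' - g') = (w - w') - (g - g') by abel, inner_sub_right, Complex.sub_re]
    nlinarith) ht
  simp only [Pi.sub_apply] at h
  rw [hu.initial, hu'.initial] at h
  have : 2 * (2 * a * M ^ 2) * t ≤ 2 * (2 * a * M ^ 2) * T := by
    gcongr
    exact ht.2
  linarith

end VeryWeakHeat

theorem mainTheorem3 (d : ℕ) (T : ℝ) (hT : 0 < T)
    (ω : ℝ → ℝ) (hω_pos : ∀ ε ∈ Set.Ioc (0 : ℝ) 1, 0 < ω ε)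
    (hω_lim : Filter.Tendsto ω (nhdsWithin 0 (Set.Ioi 0)) (nhds 0))
    (q : VeryWeakHeat.Distrib d) (u₀ : VeryWeakHeat.H1 d) :
    VeryWeakHeat.VeryWeakSolutionUnique T ω q u₀ := by
  intro qe qe' u₀e u₀e' hqe hqe' hue hue' hnq hnu u u' hu hu' N hN
  obtain ⟨ψ, hψ, hψu⟩ := hue.regularisation
  obtain ⟨ψ', hψ', hψu'⟩ := hue'.regularisation
  -- The estimate bounds the squared norm but is linear in the coefficient difference, hence the
  -- order `2 * N` here and `N` for the data.
  obtain ⟨A, hA⟩ := hnq (2 * N) (by omega)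
  obtain ⟨B, hB⟩ := hnu N hN
  set M := ‖VeryWeakHeat.toL2 u₀‖
  set K := |B| ^ 2 + 4 * |A| * M ^ 2 * T with hK
  have hK0 : 0 ≤ K := by positivity
  refine ⟨√K, fun ε hε t ht => ?_⟩
  have hε0 : 0 < ε := hε.1
  have hM : ‖VeryWeakHeat.toL2 (u₀e ε)‖ ≤ M := hψ.norm_le_of_ae_eq_mollify (hω_pos ε hε) (hψu ε hε)
  have hM' : ‖VeryWeakHeat.toL2 (u₀e' ε)‖ ≤ M := hψ'.norm_le_of_ae_eq_mollify (hω_pos ε hε) (hψu' ε hε)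
  have hq : ∀ᵐ x, |qe ε x - qe' ε x| ≤ |A| * ε ^ (2 * N) := by
    have h1 := hA ε hε
    simp only [eLpNorm_exponent_top] at h1
    filter_upwards [enorm_ae_le_eLpNormEssSup (qe ε - qe' ε) volume] with x hx
    have h2 := (hx.trans h1).trans
      (ENNReal.ofReal_le_ofReal (by gcongr; exact le_abs_self A :
        A * ε ^ (2 * N) ≤ |A| * ε ^ (2 * N)))
    rwa [← ofReal_norm, ENNReal.ofReal_le_ofReal_iff (by positivity), Pi.sub_apply,
      Real.norm_eq_abs] at h2
  have hu0 : ‖VeryWeakHeat.toL2 (u₀e ε) - VeryWeakHeat.toL2 (u₀e' ε)‖ ≤ |B| * ε ^ N := by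
    have h1 : ‖VeryWeakHeat.toL2 (u₀e ε) - VeryWeakHeat.toL2 (u₀e' ε)‖ₑ ≤ ENNReal.ofReal (B * ε ^ N) := hB ε hε
    have h2 := h1.trans
      (ENNReal.ofReal_le_ofReal (by gcongr; exact le_abs_self B : B * ε ^ N ≤ |B| * ε ^ N))
    rwa [← ofReal_norm, ENNReal.ofReal_le_ofReal_iff (by positivity)] at h2
  have h := (hu ε hε).norm_sub_sq_le (hqe.nonneg ε hε) (hqe'.nonneg ε hε) (by positivity) hq
    (hu' ε hε) hM hM' ht
  refine le_of_sq_le_sq ?_ (by positivity)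
  calc _ ≤ _ := h
    _ ≤ (|B| * ε ^ N) ^ 2 + 4 * (|A| * ε ^ (2 * N)) * M ^ 2 * T := by gcongr
    _ = K * (ε ^ N) ^ 2 := by rw [hK, mul_comm 2 N, pow_mul]; ring
    _ = (√K * ε ^ N) ^ 2 := by rw [mul_pow, Real.sq_sqrt hK0]
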